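/- Let $(\alpha_n)_{n\ge 0}$ be a sequence in the open unit disk $\mathbb{D}=\{z\in\mathbb{C}:|z|<1\}$ that is periodic, i.e. there is an integer $p\ge 1$ with $\alpha_{n+p}=\alpha_n$ for all $n\ge 0$, and suppose that the $\alpha_n$ are not all $0$. Let $\varphi_0=1$ and, for $n\ge 0$, $$\varphi_{n+1}(z)=\rho_n^{-1}\bigl(z\varphi_n(z)-\overline{\alpha_n}\,\varphi_n^*(z)\bigr),\qquad \rho_n=(1-|\alpha_n|^2)^{1/2},\qquad \varphi_n^*(z)=z^n\,\overline{\varphi_n(1/\bar z)},$$ and let $\mu$ be the probability measure on the unit circle $\partial\mathbb{D}$ with Verblunsky coefficients $(\alpha_n)$, i.e. the measure for which the polynomials $\varphi_n$ are orthonormal: $\int_{\partial\mathbb{D}}\overline{\varphi_m}\,\varphi_n\,d\mu=\delta_{mn}$ for all $m,n\ge 0$. Then, for every $z_0\in\mathbb{C}$, the following are equivalent: 1. $z_0$ is a limit of zeros of $\varphi_n$, i.e. there are $z_n\in\mathbb{C}$ ($n\ge 1$) with $\varphi_n(z_n)=0$ for every $n\ge 1$ and $z_n\to z_0$ as $n\to\infty$;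 2. $z_0$ lies in the support of $\mu$. -/

import Mathlib

open MeasureTheory Filter Topology Polynomial

namespace OPUC

/-- `ρ = (1 - |α|²)^{1/2}`. -/
noncomputable def rho (a : ℂ) : ℝ := Real.sqrt (1 - ‖a‖ ^ 2)

/-- The reversed polynomial of degree at most `n`: the coefficients `c₀, …, cₙ` become
`conj cₙ, …, conj c₀`. For `z ≠ 0` its value is `zⁿ * conj (P (1 / conj z))`. -/
noncomputable def reversed (n : ℕ) (P : ℂ[X]) : ℂ[X] :=
  (P.map (starRingEnd ℂ)).reflect n

theorem eval_reversed {n : ℕ} {P : ℂ[X]} (hP : P.natDegree ≤ n) {z : ℂ} (hz : z ≠ 0) :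
    (reversed n P).eval z
      = z ^ n * (starRingEnd ℂ) (P.eval (1 / (starRingEnd ℂ) z)) := by
  have hQ : (P.map (starRingEnd ℂ)).natDegree ≤ n := le_trans natDegree_map_le hP
  have : Invertible z⁻¹ := invertibleOfNonzero (inv_ne_zero hz)
  have h := eval₂_reflect_mul_pow (RingHom.id ℂ) z⁻¹ n (P.map (starRingEnd ℂ)) hQ
  have h2 : (starRingEnd ℂ) (P.eval (1 / (starRingEnd ℂ) z))
      = (P.map (starRingEnd ℂ)).eval z⁻¹ := by
    have h3 := Polynomial.hom_eval₂ P (RingHom.id ℂ) (starRingEnd ℂ) (1 / (starRingEnd ℂ) z)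
    simpa [eval_map, Polynomial.eval₂_id] using h3
  rw [h2]
  simp only [invOf_eq_inv, inv_inv, eval₂_id] at h
  rw [← h, reversed, mul_comm, mul_assoc, ← mul_pow, inv_mul_cancel₀ hz, one_pow, mul_one]

/-- The polynomials generated by the Szegő recursion
`φ₀ = 1`, `φₙ₊₁(z) = ρₙ⁻¹ (z φₙ(z) - conj αₙ φₙ*(z))` from coefficients `α₀, α₁, …`. -/
noncomputable def phi (α : ℕ → ℂ) : ℕ → ℂ[X]
  | 0 => 1
  | n + 1 => C ((rho (α n) : ℂ)⁻¹) *
      (X * phi α n - C ((starRingEnd ℂ) (α n)) * reversed n (phi α n))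

/-- `μ` is the probability measure on the unit circle, regarded as a measure on `ℂ` that gives no
mass to the complement of the circle, whose Verblunsky coefficients are `α`: all `αₙ` lie in the
open unit disk, and the polynomials that they generate by the Szegő recursion are the orthonormal
polynomials of `μ`. -/
structure IsVerblunsky (μ : Measure ℂ) (α : ℕ → ℂ) : Prop where
  isProbabilityMeasure : IsProbabilityMeasure μ
  compl_circle : μ (Metric.sphere (0 : ℂ) 1)ᶜ = 0
  norm_lt_one : ∀ n, ‖α n‖ < 1
  orthonormal : ∀ m n : ℕ,
    ∫ z, (starRingEnd ℂ) ((phi α m).eval z) * (phi α n).eval z ∂μ = if m = n then 1 else 0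

/-- `z₀` is a limit of zeros of `P₁, P₂, …`: there are zeros `zₙ` of `Pₙ`, one for every
`n ≥ 1`, with `zₙ → z₀`. (`P₀` is left out because it is a nonzero constant for
orthogonal polynomials.) -/
def IsLimitOfZeros (P : ℕ → ℂ[X]) (z₀ : ℂ) : Prop :=
  ∃ z : ℕ → ℂ, (∀ n, 1 ≤ n → (P n).eval (z n) = 0) ∧ Tendsto z atTop (𝓝 z₀)

end OPUC

/-!
Every zero of `φₙ` lies in the open disk, and `φₙ / φₙ*` is a Blaschke product there. On the
diagonal the Christoffel–Darboux formula reads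
`|φₙ*|² - |φₙ|² = (1 - |z|²) ∑_{k < n} |φₖ|²` (`norm_sq_reversed_phi_sub`).

*Limits of zeros lie in the support.* If `φₙ = (z - a) q`, then `φₙ ⟂ q` and the isometry of
multiplication by `z` give `(1 - |a|²) ‖q‖² = 1` in `L²(μ)`. Hence `|a| < 1`, and
`1 - |a|² ≥ d²` if `a` has distance at least `d` from the support, so that zeros cannot approach a
point of the circle off the support (`IsVerblunsky.sq_le_one_sub_norm_sq`). If zeros converge to a
point `z₀` of the open disk, the Blaschke product makes `φₙ(z₀) / φₙ*(z₀)` tend to `0`, and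
then the recursion makes `αₙ` tend to `0` (`IsVerblunsky.tendsto_zero_of_isLimitOfZeros`), which
periodicity excludes.

*Points of the support are limits of zeros.* Let `B` be the upper right entry of the transfer matrix
over one period; as not all `αₙ` vanish, it is a nonzero polynomial, and `B(w) ≠ 0` for some `w` in
the disk and all starting indices. The Wronskian of `(φₙ, φₙ*)` and `(φₙ₊ₚ, φₙ₊ₚ*)` at `w` is a
multiple of `wⁿ`, so it tends to `0`, and therefore `|φₙ / φₙ*|` is bounded below at `w`
(`exists_lower_bound`). For a Blaschke product this bounds the sum of `1 - |a|²` over the zeros `a`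
of `φₙ`, uniformly in `n` (`IsVerblunsky.exists_sum_roots_le`).

If now infinitely many `φₙ` had no zero near `z₀`, then for these `n` the Poisson kernels of the
zeros would be bounded by multiples of `1 - |a|²` on an arc around `z₀`, and letting `z` tend to the
circle in the Christoffel–Darboux formula would give `∑_{k < n} |φₖ|² ≤ C |φₙ|²` on the arc
(`IsVerblunsky.sum_norm_sq_phi_le`). Integration against `μ` shows that `∑ₖ |φₖ|²` is finite
almost everywhere on the arc. The arc has positive measure when `z₀` is in the support, so it has a
point at which this sum converges; there `φₙ → 0`, and the inequality contradicts `φ₀ = 1`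
(`IsVerblunsky.eventually_exists_root`).
-/

namespace OPUC

open scoped ComplexConjugate

/-! ### Reversed polynomials -/

lemma rho_pos {a : ℂ} (ha : ‖a‖ < 1) : 0 < rho a := by
  have := norm_nonneg a
  exact Real.sqrt_pos.2 (by nlinarith)

lemma rho_sq {a : ℂ} (ha : ‖a‖ < 1) : rho a ^ 2 = 1 - ‖a‖ ^ 2 := by
  have := norm_nonneg a
  exact Real.sq_sqrt (by nlinarith)

lemma ofReal_rho_ne_zero {a : ℂ} (ha : ‖a‖ < 1) : (rho a : ℂ) ≠ 0 :=
  Complex.ofReal_ne_zero.2 (rho_pos ha).ne'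

lemma reversed_mul {m n : ℕ} {P Q : ℂ[X]} (hP : P.natDegree ≤ m) (hQ : Q.natDegree ≤ n) :
    reversed (m + n) (P * Q) = reversed m P * reversed n Q := by
  rw [reversed, Polynomial.map_mul]
  exact reflect_mul _ _ (natDegree_map_le.trans hP) (natDegree_map_le.trans hQ)

lemma reversed_sub (n : ℕ) (P Q : ℂ[X]) :
    reversed n (P - Q) = reversed n P - reversed n Q := by
  simp [reversed, Polynomial.map_sub, reflect_sub]

lemma reversed_C_mul (n : ℕ) (c : ℂ) (P : ℂ[X]) :
    reversed n (C c * P) = C (conj c) * reversed n P := by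
  simp [reversed, reflect_C_mul]

lemma coeff_reversed (n k : ℕ) (P : ℂ[X]) :
    (reversed n P).coeff k = conj (P.coeff (revAt n k)) := by
  simp [reversed, coeff_reflect]

lemma reversed_reversed (n : ℕ) (P : ℂ[X]) : reversed n (reversed n P) = P := by
  ext k
  simp [coeff_reversed]

lemma natDegree_reversed_le {n : ℕ} {P : ℂ[X]} (hP : P.natDegree ≤ n) :
    (reversed n P).natDegree ≤ n := by
  refine natDegree_le_iff_coeff_eq_zero.2 fun k hk => ?_
  rw [coeff_reversed, revAt_eq_self_of_lt hk, coeff_eq_zero_of_natDegree_lt (hP.trans_lt hk),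
    map_zero]

lemma reversed_one_X : reversed 1 X = 1 := by
  have h : (X : ℂ[X]).map (starRingEnd ℂ) = C 1 * X ^ 1 := by simp
  rw [reversed, h, reflect_C_mul_X_pow]
  simp [revAt_le le_rfl]

lemma reversed_one_one : reversed 1 1 = X := by
  rw [← reversed_one_X, reversed_reversed]

lemma reversed_zero_one : reversed 0 1 = 1 := by
  simp [reversed]

lemma reversed_succ_X_mul {n : ℕ} {P : ℂ[X]} (hP : P.natDegree ≤ n) :
    reversed (n + 1) (X * P) = reversed n P := by
  rw [add_comm, reversed_mul natDegree_X_le hP, reversed_one_X, one_mul]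

lemma reversed_succ {n : ℕ} {P : ℂ[X]} (hP : P.natDegree ≤ n) :
    reversed (n + 1) P = X * reversed n P := by
  have := reversed_mul (m := 1) (n := n) (P := 1) (Q := P) (by simp) hP
  rwa [one_mul, add_comm 1 n, reversed_one_one] at this

/-- Reversion turns each factor `X - a` into `1 - conj a * X`. -/
lemma reversed_prod_X_sub_C (s : Multiset ℂ) :
    reversed s.card (s.map fun a => X - C a).prod
      = (s.map fun a => 1 - C (conj a) * X).prod := by
  induction s using Multiset.induction_on with
  | empty => simp [reversed]
  | cons a s ih =>
    have h1 : reversed 1 (X - C a) = 1 - C (conj a) * X := by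
      have := reversed_C_mul 1 a 1
      rw [mul_one, reversed_one_one] at this
      rw [reversed_sub, reversed_one_X, this]
    have hs : ((s.map fun a => X - C a).prod).natDegree ≤ s.card :=
      (natDegree_multiset_prod_X_sub_C_eq_card s).le
    rw [Multiset.map_cons, Multiset.prod_cons, Multiset.card_cons, add_comm,
      reversed_mul (natDegree_X_sub_C_le a) hs, ih, h1, Multiset.map_cons, Multiset.prod_cons]

/-! ### The Szegő recursion and the Christoffel–Darboux formula -/

section Recursion

variable {α : ℕ → ℂ}

lemma natDegree_phi_le (α : ℕ → ℂ) (n : ℕ) : (phi α n).natDegree ≤ n := by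
  induction n with
  | zero => simp [phi]
  | succ n ih =>
    have h1 : (X * phi α n).natDegree ≤ n + 1 := by
      rw [add_comm]
      exact natDegree_mul_le_of_le natDegree_X_le ih
    have h2 : (C (conj (α n)) * reversed n (phi α n)).natDegree ≤ n + 1 :=
      (natDegree_C_mul_le _ _).trans ((natDegree_reversed_le ih).trans n.le_succ)
    exact (natDegree_C_mul_le _ _).trans (natDegree_sub_le_of_le h1 h2 |>.trans (by simp))

lemma coeff_phi_ne_zero (hα : ∀ n, ‖α n‖ < 1) (n : ℕ) : (phi α n).coeff n ≠ 0 := by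
  induction n with
  | zero => simp [phi]
  | succ n ih =>
    have h : (reversed n (phi α n)).coeff (n + 1) = 0 :=
      coeff_eq_zero_of_natDegree_lt
        ((natDegree_reversed_le (natDegree_phi_le α n)).trans_lt n.lt_succ_self)
    simp [phi, h, ih, ofReal_rho_ne_zero (hα n)]

lemma phi_ne_zero (hα : ∀ n, ‖α n‖ < 1) (n : ℕ) : phi α n ≠ 0 := fun h =>
  coeff_phi_ne_zero hα n (by simp [h])

lemma natDegree_phi (hα : ∀ n, ‖α n‖ < 1) (n : ℕ) : (phi α n).natDegree = n :=
  le_antisymm (natDegree_phi_le α n) (le_natDegree_of_ne_zero (coeff_phi_ne_zero hα n))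

lemma reversed_phi_succ (α : ℕ → ℂ) (n : ℕ) :
    reversed (n + 1) (phi α (n + 1))
      = C ((rho (α n) : ℂ)⁻¹) * (reversed n (phi α n) - C (α n) * (X * phi α n)) := by
  have hP := natDegree_phi_le α n
  rw [phi, reversed_C_mul, reversed_sub, reversed_C_mul, reversed_succ_X_mul hP,
    reversed_succ (natDegree_reversed_le hP), reversed_reversed]
  simp

lemma rho_mul_eval_phi_succ (hα : ∀ n, ‖α n‖ < 1) (n : ℕ) (z : ℂ) :
    (rho (α n) : ℂ) * (phi α (n + 1)).eval z
      = z * (phi α n).eval z - conj (α n) * (reversed n (phi α n)).eval z := by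
  simp [phi, mul_inv_cancel_left₀ (ofReal_rho_ne_zero (hα n))]

lemma rho_mul_eval_reversed_phi_succ (hα : ∀ n, ‖α n‖ < 1) (n : ℕ) (z : ℂ) :
    (rho (α n) : ℂ) * (reversed (n + 1) (phi α (n + 1))).eval z
      = (reversed n (phi α n)).eval z - α n * (z * (phi α n).eval z) := by
  simp [reversed_phi_succ, mul_inv_cancel_left₀ (ofReal_rho_ne_zero (hα n))]

lemma norm_sq_sub_norm_sq (a x y : ℂ) :
    ‖y - a * x‖ ^ 2 - ‖x - conj a * y‖ ^ 2 = (1 - ‖a‖ ^ 2) * (‖y‖ ^ 2 - ‖x‖ ^ 2) := by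
  simp only [Complex.sq_norm, Complex.normSq_apply, Complex.sub_re, Complex.sub_im,
    Complex.mul_re, Complex.mul_im, Complex.conj_re, Complex.conj_im]
  ring

/-- The Christoffel–Darboux formula on the diagonal. -/
lemma norm_sq_reversed_phi_sub (hα : ∀ n, ‖α n‖ < 1) (n : ℕ) (z : ℂ) :
    ‖(reversed n (phi α n)).eval z‖ ^ 2 - ‖(phi α n).eval z‖ ^ 2
      = (1 - ‖z‖ ^ 2) * ∑ k ∈ Finset.range n, ‖(phi α k).eval z‖ ^ 2 := by
  induction n with
  | zero => simp [phi, reversed_zero_one]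
  | succ n ih =>
    have h := norm_sq_sub_norm_sq (α n) (z * (phi α n).eval z) ((reversed n (phi α n)).eval z)
    rw [← rho_mul_eval_phi_succ hα, ← rho_mul_eval_reversed_phi_succ hα, norm_mul, norm_mul,
      norm_mul, mul_pow, mul_pow, mul_pow, Complex.norm_real, Real.norm_eq_abs, sq_abs, ← mul_sub,
      ← rho_sq (hα n)] at h
    have h2 := mul_left_cancel₀ (pow_ne_zero 2 (rho_pos (hα n)).ne') h
    rw [h2, Finset.sum_range_succ, mul_add, ← ih]
    ring

lemma one_le_sum_norm_sq_phi (α : ℕ → ℂ) {n : ℕ} (hn : 1 ≤ n) (z : ℂ) :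
    1 ≤ ∑ k ∈ Finset.range n, ‖(phi α k).eval z‖ ^ 2 := by
  have h : ‖(phi α 0).eval z‖ ^ 2 = 1 := by simp [phi]
  rw [← h]
  exact Finset.single_le_sum (f := fun k => ‖(phi α k).eval z‖ ^ 2)
    (fun k _ => by positivity) (Finset.mem_range.2 hn)

lemma norm_phi_le_norm_reversed (hα : ∀ n, ‖α n‖ < 1) (n : ℕ) {z : ℂ} (hz : ‖z‖ < 1) :
    ‖(phi α n).eval z‖ ≤ ‖(reversed n (phi α n)).eval z‖ := by
  have h := norm_sq_reversed_phi_sub hα n z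
  have h1 : 0 ≤ 1 - ‖z‖ ^ 2 := by nlinarith [norm_nonneg z]
  have h2 : 0 ≤ (1 - ‖z‖ ^ 2) * ∑ k ∈ Finset.range n, ‖(phi α k).eval z‖ ^ 2 :=
    mul_nonneg h1 (Finset.sum_nonneg fun k _ => by positivity)
  exact (sq_le_sq₀ (norm_nonneg _) (norm_nonneg _)).1 (by linarith)

lemma one_sub_norm_sq_le_norm_sq_reversed (hα : ∀ n, ‖α n‖ < 1) (n : ℕ) {z : ℂ} (hz : ‖z‖ < 1) :
    1 - ‖z‖ ^ 2 ≤ ‖(reversed n (phi α n)).eval z‖ ^ 2 := by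
  have h1 : 0 ≤ 1 - ‖z‖ ^ 2 := by nlinarith [norm_nonneg z]
  rcases Nat.eq_zero_or_pos n with rfl | hn
  · simp [phi, reversed_zero_one]
  · have h := norm_sq_reversed_phi_sub hα n z
    have h2 := mul_le_mul_of_nonneg_left (one_le_sum_norm_sq_phi α hn z) h1
    nlinarith [sq_nonneg ‖(phi α n).eval z‖]

lemma reversed_phi_eval_ne_zero (hα : ∀ n, ‖α n‖ < 1) (n : ℕ) {z : ℂ} (hz : ‖z‖ < 1) :
    (reversed n (phi α n)).eval z ≠ 0 := by
  intro h
  have := one_sub_norm_sq_le_norm_sq_reversed hα n hz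
  rw [h, norm_zero] at this
  nlinarith [norm_nonneg z]

lemma norm_reversed_phi_of_norm_eq_one (α : ℕ → ℂ) (n : ℕ) {z : ℂ} (hz : ‖z‖ = 1) :
    ‖(reversed n (phi α n)).eval z‖ = ‖(phi α n).eval z‖ := by
  have hz0 : z ≠ 0 := by rintro rfl; simp at hz
  have h : 1 / conj z = z := by
    rw [one_div, ← Complex.inv_eq_conj hz, inv_inv]
  rw [eval_reversed (natDegree_phi_le α n) hz0, h]
  simp [hz]

end Recursion

/-! ### Blaschke products -/

section Blaschke

lemma one_sub_sum_le_prod {s : Multiset ℂ} {x : ℂ → ℝ} (h0 : ∀ a ∈ s, 0 ≤ x a)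
    (h1 : ∀ a ∈ s, x a ≤ 1) :
    1 - (s.map fun a => 1 - x a).sum ≤ (s.map x).prod ∧ (s.map x).prod ≤ 1 ∧
      0 ≤ (s.map x).prod := by
  induction s using Multiset.induction_on with
  | empty => simp
  | cons a s ih =>
    obtain ⟨i1, i2, i3⟩ := ih (fun b hb => h0 b (Multiset.mem_cons_of_mem hb))
      (fun b hb => h1 b (Multiset.mem_cons_of_mem hb))
    have a0 := h0 a (Multiset.mem_cons_self a s)
    have a1 := h1 a (Multiset.mem_cons_self a s)
    simp only [Multiset.map_cons, Multiset.sum_cons, Multiset.prod_cons]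
    refine ⟨?_, by nlinarith, by positivity⟩
    nlinarith [mul_nonneg (sub_nonneg.2 a1) (sub_nonneg.2 i2)]

lemma prod_le_exp_neg_sum {s : Multiset ℂ} {x : ℂ → ℝ} (h0 : ∀ a ∈ s, 0 ≤ x a) :
    (s.map x).prod ≤ Real.exp (-(s.map fun a => 1 - x a).sum) := by
  have key : ∀ a ∈ s, x a ≤ Real.exp (-(1 - x a)) := fun a _ => by
    have := Real.add_one_le_exp (-(1 - x a))
    linarith
  calc (s.map x).prod ≤ (s.map fun a => Real.exp (-(1 - x a))).prod :=
        Multiset.prod_map_le_prod_map₀ _ _ h0 key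
    _ = _ := by
      rw [← Multiset.sum_map_neg', Real.exp_multiset_sum, Multiset.map_map, Multiset.map_map]
      rfl

lemma norm_one_sub_conj_mul_sq_sub (a z : ℂ) :
    ‖1 - conj a * z‖ ^ 2 - ‖z - a‖ ^ 2 = (1 - ‖z‖ ^ 2) * (1 - ‖a‖ ^ 2) := by
  have h := norm_sq_sub_norm_sq (conj a) z 1
  simp only [Complex.conj_conj, mul_one, norm_one, one_pow, RCLike.norm_conj] at h
  rw [h]; ring

lemma one_sub_conj_mul_ne_zero {a z : ℂ} (ha : ‖a‖ < 1) (hz : ‖z‖ ≤ 1) : 1 - conj a * z ≠ 0 := by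
  intro h
  have h2 : ‖conj a * z‖ = 1 := by rw [← sub_eq_zero.1 h, norm_one]
  rw [norm_mul, RCLike.norm_conj] at h2
  nlinarith [norm_nonneg a, norm_nonneg z]

/-- The squared modulus at `z` of the Blaschke factor with zero `a`. -/
noncomputable def blaschkeSq (z a : ℂ) : ℝ := ‖z - a‖ ^ 2 / ‖1 - conj a * z‖ ^ 2

lemma blaschkeSq_nonneg (z a : ℂ) : 0 ≤ blaschkeSq z a := by
  unfold blaschkeSq; positivity

lemma one_sub_blaschkeSq {a z : ℂ} (ha : ‖a‖ < 1) (hz : ‖z‖ ≤ 1) :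
    1 - blaschkeSq z a = (1 - ‖z‖ ^ 2) * (1 - ‖a‖ ^ 2) / ‖1 - conj a * z‖ ^ 2 := by
  have h : ‖1 - conj a * z‖ ^ 2 ≠ 0 :=
    pow_ne_zero 2 (norm_ne_zero_iff.2 (one_sub_conj_mul_ne_zero ha hz))
  rw [← norm_one_sub_conj_mul_sq_sub, sub_div, div_self h, blaschkeSq]

lemma blaschkeSq_le_one {a z : ℂ} (ha : ‖a‖ < 1) (hz : ‖z‖ ≤ 1) : blaschkeSq z a ≤ 1 := by
  rw [← sub_nonneg, one_sub_blaschkeSq ha hz]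
  have := norm_nonneg a
  have := norm_nonneg z
  have : 0 ≤ 1 - ‖a‖ ^ 2 := by nlinarith
  have : 0 ≤ 1 - ‖z‖ ^ 2 := by nlinarith
  positivity

variable {α : ℕ → ℂ}

/-- `φₙ / φₙ*` is a Blaschke product up to a unimodular constant. -/
lemma norm_phi_sq_eq (hα : ∀ n, ‖α n‖ < 1) (n : ℕ) (hroots : ∀ a ∈ (phi α n).roots, ‖a‖ < 1)
    {z : ℂ} (hz : ‖z‖ ≤ 1) :
    ‖(phi α n).eval z‖ ^ 2
      = ((phi α n).roots.map (blaschkeSq z)).prod * ‖(reversed n (phi α n)).eval z‖ ^ 2 := by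
  set s := (phi α n).roots with hs
  have hsplit : (phi α n).Splits := IsAlgClosed.splits _
  have hcard : s.card = n := by
    rw [hs, ← hsplit.natDegree_eq_card_roots, natDegree_phi hα]
  have hP : phi α n = C (phi α n).leadingCoeff * (s.map fun a => X - C a).prod :=
    hsplit.eq_prod_roots
  have hR : reversed n (phi α n)
      = C (conj (phi α n).leadingCoeff) * (s.map fun a => 1 - C (conj a) * X).prod := by
    conv_lhs => rw [hP]
    rw [reversed_C_mul, ← reversed_prod_X_sub_C, hcard]
  have hprod : ∀ t : Multiset ℂ, (∀ a ∈ t, ‖a‖ < 1) →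
      ‖((t.map fun a => X - C a).prod).eval z‖ ^ 2
        = (t.map (blaschkeSq z)).prod
          * ‖((t.map fun a => 1 - C (conj a) * X).prod).eval z‖ ^ 2 := by
    intro t
    induction t using Multiset.induction_on with
    | empty => simp
    | cons a t ih =>
      intro ht
      have h : ‖1 - conj a * z‖ ^ 2 ≠ 0 := pow_ne_zero 2 (norm_ne_zero_iff.2
        (one_sub_conj_mul_ne_zero (ht a (Multiset.mem_cons_self a t)) hz))
      have ih' := ih fun b hb => ht b (Multiset.mem_cons_of_mem hb)
      have hb : ‖z - a‖ ^ 2 = blaschkeSq z a * ‖1 - conj a * z‖ ^ 2 := by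
        rw [blaschkeSq, div_mul_cancel₀ _ h]
      simp only [Multiset.map_cons, Multiset.prod_cons, eval_mul, norm_mul, mul_pow, ih',
        eval_sub, eval_X, eval_C, eval_one, hb]
      ring
  rw [hR]
  conv_lhs => rw [hP]
  simp only [eval_mul, norm_mul, mul_pow, eval_C, hprod s hroots, RCLike.norm_conj]
  ring

end Blaschke

/-! ### Zeros away from the support -/

section Measure

variable {μ : Measure ℂ} {α : ℕ → ℂ}

lemma IsVerblunsky.ae_norm_eq_one (h : IsVerblunsky μ α) : ∀ᵐ z ∂μ, ‖z‖ = 1 := by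
  have h1 : ∀ᵐ z ∂μ, z ∈ Metric.sphere (0 : ℂ) 1 := by
    rw [ae_iff]
    exact h.compl_circle
  filter_upwards [h1] with z hz
  simpa using hz

lemma IsVerblunsky.integrable (h : IsVerblunsky μ α) {E : Type*} [NormedAddCommGroup E]
    {f : ℂ → E} (hf : Continuous f) : Integrable f μ := by
  have := h.isProbabilityMeasure
  have h1 : ∀ᵐ z ∂μ, z ∈ Metric.sphere (0 : ℂ) 1 := by
    rw [ae_iff]
    exact h.compl_circle
  rw [← Measure.restrict_eq_self_of_ae_mem h1]
  exact hf.continuousOn.integrableOn_compact (isCompact_sphere 0 1)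

lemma IsVerblunsky.integral_norm_sq_phi (h : IsVerblunsky μ α) (n : ℕ) :
    ∫ z, ‖(phi α n).eval z‖ ^ 2 ∂μ = 1 := by
  have h1 := h.orthonormal n n
  simp only [Complex.conj_mul', if_true] at h1
  have h2 : ∫ z, ((‖(phi α n).eval z‖ ^ 2 : ℝ) : ℂ) ∂μ = 1 := by simpa using h1
  rw [integral_complex_ofReal] at h2
  exact_mod_cast h2

/-- `φₙ` is orthogonal to all polynomials of smaller degree. -/
lemma IsVerblunsky.integral_conj_mul_phi (h : IsVerblunsky μ α) {n : ℕ} (P : ℂ[X])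
    (hP : P.degree < n) : ∫ z, conj (P.eval z) * (phi α n).eval z ∂μ = 0 := by
  suffices H : ∀ d ≤ n, ∀ P : ℂ[X], P.degree < d →
      ∫ z, conj (P.eval z) * (phi α n).eval z ∂μ = 0 from H n le_rfl P hP
  intro d
  induction d with
  | zero =>
    intro _ P hP
    have : P = 0 := by
      rw [← degree_eq_bot]
      simpa using hP
    simp [this]
  | succ d ih =>
    intro hd P hP
    -- Cancel the coefficient of degree `d` with a multiple of `phi α d`.
    set c := P.coeff d / (phi α d).coeff d with hc
    have hQ : (P - C c * phi α d).degree < d := by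
      refine (degree_lt_iff_coeff_zero _ _).2 fun k hk => ?_
      rcases hk.eq_or_lt with rfl | hk
      · simp [hc, coeff_phi_ne_zero h.norm_lt_one d]
      · have h1 : P.coeff k = 0 := (degree_lt_iff_coeff_zero _ _).1 hP k hk
        have h2 : (phi α d).coeff k = 0 :=
          coeff_eq_zero_of_natDegree_lt ((natDegree_phi_le α d).trans_lt hk)
        simp [h1, h2]
    have h3 := ih (by omega) _ hQ
    have h4 : ∀ z, conj (P.eval z) * (phi α n).eval z
        = conj ((P - C c * phi α d).eval z) * (phi α n).eval z
          + conj c * (conj ((phi α d).eval z) * (phi α n).eval z) := by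
      intro z
      simp
      ring
    simp_rw [h4]
    rw [integral_add (h.integrable (by fun_prop)) (h.integrable (by fun_prop)), h3,
      integral_const_mul, h.orthonormal, if_neg (by omega)]
    simp

/-- If `φₙ = (z - a) q` then `‖z q‖² = ‖a q‖² + ‖φₙ‖²` in `L²(μ)` because `φₙ ⟂ q`, and
multiplication by `z` is isometric. -/
lemma IsVerblunsky.one_sub_norm_sq_mul_integral (h : IsVerblunsky μ α) {n : ℕ} {a : ℂ} {q : ℂ[X]}
    (hq : phi α n = (X - C a) * q) : (1 - ‖a‖ ^ 2) * ∫ z, ‖q.eval z‖ ^ 2 ∂μ = 1 := by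
  have hq0 : q ≠ 0 := by
    rintro rfl
    exact phi_ne_zero h.norm_lt_one n (by simpa using hq)
  have hdeg : q.degree < n := by
    have h1 : (phi α n).natDegree = 1 + q.natDegree := by
      rw [hq, natDegree_mul (X_sub_C_ne_zero a) hq0, natDegree_X_sub_C]
    rw [natDegree_phi h.norm_lt_one] at h1
    rw [degree_eq_natDegree hq0]
    exact_mod_cast (by omega : q.natDegree < n)
  have horth := h.integral_conj_mul_phi q hdeg
  have hre : ∫ z, (conj a * (conj (q.eval z) * (phi α n).eval z)).re ∂μ = 0 := by
    have := integral_re (𝕜 := ℂ) (μ := μ)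
      (f := fun z => conj a * (conj (q.eval z) * (phi α n).eval z)) (h.integrable (by fun_prop))
    simp only [RCLike.re_to_complex] at this
    rw [this, integral_const_mul, horth]
    simp
  have hpt : ∀ᵐ z ∂μ, ‖q.eval z‖ ^ 2 = ‖a‖ ^ 2 * ‖q.eval z‖ ^ 2 + ‖(phi α n).eval z‖ ^ 2
      + 2 * (conj a * (conj (q.eval z) * (phi α n).eval z)).re := by
    filter_upwards [h.ae_norm_eq_one] with z hz
    have h1 : ‖q.eval z‖ = ‖a * q.eval z + (phi α n).eval z‖ := by
      rw [hq, eval_mul, eval_sub, eval_X, eval_C, ← add_mul, add_sub_cancel, norm_mul, hz, one_mul]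
    conv_lhs => rw [h1]
    simp only [Complex.sq_norm, Complex.normSq_apply, Complex.add_re, Complex.add_im,
      Complex.mul_re, Complex.mul_im, Complex.conj_re, Complex.conj_im]
    ring
  have hint := integral_congr_ae hpt
  rw [integral_add (h.integrable (by fun_prop)) (h.integrable (by fun_prop)),
    integral_add (h.integrable (by fun_prop)) (h.integrable (by fun_prop)),
    integral_const_mul, integral_const_mul, hre, h.integral_norm_sq_phi] at hint
  linarith

lemma IsVerblunsky.norm_root_lt_one (h : IsVerblunsky μ α) {n : ℕ} {a : ℂ}
    (ha : (phi α n).eval a = 0) : ‖a‖ < 1 := by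
  obtain ⟨q, hq⟩ := dvd_iff_isRoot.2 ha
  have h1 := h.one_sub_norm_sq_mul_integral hq
  have h2 : 0 ≤ ∫ z, ‖q.eval z‖ ^ 2 ∂μ := integral_nonneg fun z => by positivity
  by_contra! h3
  have : 1 - ‖a‖ ^ 2 ≤ 0 := by nlinarith
  nlinarith [mul_nonneg (neg_nonneg.2 this) h2]

lemma IsVerblunsky.norm_lt_one_of_mem_roots (h : IsVerblunsky μ α) (n : ℕ) :
    ∀ a ∈ (phi α n).roots, ‖a‖ < 1 := fun _ ha =>
  h.norm_root_lt_one (isRoot_of_mem_roots ha)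

/-- With `φₙ = (z - a) q` this follows from `1 = ‖φₙ‖² ≥ d² ‖q‖²` and `(1 - |a|²) ‖q‖² = 1`. -/
lemma IsVerblunsky.sq_le_one_sub_norm_sq (h : IsVerblunsky μ α) {n : ℕ} {a : ℂ} {d : ℝ}
    (hd : 0 ≤ d) (hdist : ∀ᵐ z ∂μ, d ≤ ‖z - a‖) (ha : (phi α n).eval a = 0) :
    d ^ 2 ≤ 1 - ‖a‖ ^ 2 := by
  obtain ⟨q, hq⟩ := dvd_iff_isRoot.2 ha
  have h1 := h.one_sub_norm_sq_mul_integral hq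
  have h2 : d ^ 2 * ∫ z, ‖q.eval z‖ ^ 2 ∂μ ≤ 1 := by
    rw [← h.integral_norm_sq_phi n, ← integral_const_mul]
    refine integral_mono_ae (h.integrable (by fun_prop)) (h.integrable (by fun_prop)) ?_
    filter_upwards [hdist] with z hz
    rw [hq, eval_mul, norm_mul, mul_pow]
    simp only [eval_sub, eval_X, eval_C]
    gcongr
  have h3 : 0 ≤ ∫ z, ‖q.eval z‖ ^ 2 ∂μ := integral_nonneg fun z => by positivity
  have h4 : 0 < ∫ z, ‖q.eval z‖ ^ 2 ∂μ := by
    refine h3.lt_of_ne fun h0 => ?_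
    rw [← h0] at h1
    simp at h1
  refine le_of_mul_le_mul_right ?_ h4
  rw [h1]
  exact h2

/-- The Schwarz–Pick bound for `φₙ / φₙ*` at a zero `a` of `φₙ`: all Blaschke factors but that of
`a` are dropped. -/
lemma IsVerblunsky.norm_phi_mul_le (h : IsVerblunsky μ α) {n : ℕ} {a z : ℂ}
    (ha : (phi α n).eval a = 0) (hz : ‖z‖ < 1) :
    ‖(phi α n).eval z‖ * (1 - ‖z‖) ≤ ‖z - a‖ * ‖(reversed n (phi α n)).eval z‖ := by
  have hroots := h.norm_lt_one_of_mem_roots n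
  have ha1 := h.norm_root_lt_one ha
  have hmem : a ∈ (phi α n).roots := (mem_roots (phi_ne_zero h.norm_lt_one n)).2 ha
  have h1 := norm_phi_sq_eq h.norm_lt_one n hroots hz.le
  obtain ⟨t, ht⟩ := Multiset.exists_cons_of_mem hmem
  have htm : ∀ b ∈ t, ‖b‖ < 1 := fun b hb => hroots b (by rw [ht]; exact Multiset.mem_cons_of_mem hb)
  obtain ⟨-, h2, h3⟩ := one_sub_sum_le_prod (s := t) (x := blaschkeSq z)
    (fun b _ => blaschkeSq_nonneg z b) (fun b hb => blaschkeSq_le_one (htm b hb) hz.le)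
  rw [ht, Multiset.map_cons, Multiset.prod_cons] at h1
  set v := ‖(reversed n (phi α n)).eval z‖
  have h4 : ‖(phi α n).eval z‖ ^ 2 ≤ blaschkeSq z a * v ^ 2 := by
    rw [h1]
    have := blaschkeSq_nonneg z a
    gcongr
    exact mul_le_of_le_one_right this h2
  have hden : 1 - ‖z‖ ≤ ‖1 - conj a * z‖ := by
    have h5 := norm_sub_norm_le 1 (conj a * z)
    rw [norm_one, norm_mul, RCLike.norm_conj] at h5
    nlinarith [norm_nonneg z, norm_nonneg a]
  have hz' : 0 < 1 - ‖z‖ := by linarith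
  have h6 : blaschkeSq z a * (1 - ‖z‖) ^ 2 ≤ ‖z - a‖ ^ 2 := by
    unfold blaschkeSq
    rw [div_mul_eq_mul_div, div_le_iff₀ (by have := hz'.trans_le hden; positivity)]
    gcongr
  refine (sq_le_sq₀ (by positivity) (by positivity)).1 ?_
  rw [mul_pow, mul_pow]
  calc _ ≤ blaschkeSq z a * v ^ 2 * (1 - ‖z‖) ^ 2 := by gcongr
    _ = blaschkeSq z a * (1 - ‖z‖) ^ 2 * v ^ 2 := by ring
    _ ≤ _ := by gcongr

/-- If `φₙ / φₙ*` and `φₙ₊₁ / φₙ₊₁*` are small at a point of the disk, then so is `αₙ`. -/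
lemma IsVerblunsky.tendsto_zero_of_isLimitOfZeros (h : IsVerblunsky μ α) {z₀ : ℂ}
    (hz₀ : ‖z₀‖ < 1) (hlim : IsLimitOfZeros (phi α) z₀) : Tendsto α atTop (𝓝 0) := by
  obtain ⟨z, hz, hlim⟩ := hlim
  have hα := h.norm_lt_one
  have hgap : 0 < 1 - ‖z₀‖ := by linarith
  have hdist : Tendsto (fun n => ‖z₀ - z n‖) atTop (𝓝 0) := by
    simpa [norm_sub_rev] using (tendsto_iff_norm_sub_tendsto_zero.1 hlim)
  have hbound : ∀ n, 1 ≤ n →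
      ‖α n‖ ≤ (‖z₀ - z n‖ + 2 * ‖z₀ - z (n + 1)‖) / (1 - ‖z₀‖) := by
    intro n hn
    set u := (phi α n).eval z₀
    set v := (reversed n (phi α n)).eval z₀
    set u' := (phi α (n + 1)).eval z₀
    set v' := (reversed (n + 1) (phi α (n + 1))).eval z₀
    have e1 : (rho (α n) : ℂ) * u' = z₀ * u - conj (α n) * v := rho_mul_eval_phi_succ hα n z₀
    have e2 : (rho (α n) : ℂ) * v' = v - α n * (z₀ * u) := rho_mul_eval_reversed_phi_succ hα n z₀
    have hv : 0 < ‖v‖ := norm_pos_iff.2 (reversed_phi_eval_ne_zero hα n hz₀)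
    have huv : ‖u‖ ≤ ‖v‖ := norm_phi_le_norm_reversed hα n hz₀
    have i1 : ‖u‖ * (1 - ‖z₀‖) ≤ ‖z₀ - z n‖ * ‖v‖ := h.norm_phi_mul_le (hz n hn) hz₀
    have i2 : ‖u'‖ * (1 - ‖z₀‖) ≤ ‖z₀ - z (n + 1)‖ * ‖v'‖ :=
      h.norm_phi_mul_le (hz (n + 1) (by omega)) hz₀
    have hr := rho_pos (hα n)
    have nr : ‖(rho (α n) : ℂ)‖ = rho (α n) := by simp [abs_of_pos hr]
    have hzu : ‖z₀ * u‖ ≤ ‖u‖ := by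
      rw [norm_mul]
      exact mul_le_of_le_one_left (norm_nonneg u) hz₀.le
    have j1 : ‖α n‖ * ‖v‖ ≤ ‖u‖ + rho (α n) * ‖u'‖ := by
      have : conj (α n) * v = z₀ * u - (rho (α n) : ℂ) * u' := by rw [e1]; ring
      have h2 := norm_sub_le (z₀ * u) ((rho (α n) : ℂ) * u')
      rw [← this, norm_mul (conj _), RCLike.norm_conj, norm_mul (rho _ : ℂ), nr] at h2
      linarith
    have j2 : rho (α n) * ‖v'‖ ≤ 2 * ‖v‖ := by
      have h2 := norm_sub_le v (α n * (z₀ * u))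
      rw [← e2, norm_mul, nr, norm_mul (α n)] at h2
      have : ‖α n‖ * ‖z₀ * u‖ ≤ 1 * ‖v‖ := by
        gcongr
        · exact (hα n).le
        · exact hzu.trans huv
      linarith
    rw [le_div_iff₀ hgap]
    refine le_of_mul_le_mul_right ?_ hv
    calc ‖α n‖ * (1 - ‖z₀‖) * ‖v‖ = ‖α n‖ * ‖v‖ * (1 - ‖z₀‖) := by ring
      _ ≤ (‖u‖ + rho (α n) * ‖u'‖) * (1 - ‖z₀‖) := by gcongr
      _ = ‖u‖ * (1 - ‖z₀‖) + rho (α n) * (‖u'‖ * (1 - ‖z₀‖)) := by ring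
      _ ≤ ‖z₀ - z n‖ * ‖v‖ + rho (α n) * (‖z₀ - z (n + 1)‖ * ‖v'‖) := by gcongr
      _ = ‖z₀ - z n‖ * ‖v‖ + ‖z₀ - z (n + 1)‖ * (rho (α n) * ‖v'‖) := by ring
      _ ≤ ‖z₀ - z n‖ * ‖v‖ + ‖z₀ - z (n + 1)‖ * (2 * ‖v‖) := by gcongr
      _ = _ := by ring
  have hrhs : Tendsto (fun n => (‖z₀ - z n‖ + 2 * ‖z₀ - z (n + 1)‖) / (1 - ‖z₀‖)) atTop (𝓝 0) := by
    have := (hdist.add ((hdist.comp (tendsto_add_atTop_nat 1)).const_mul 2)).div_const (1 - ‖z₀‖)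
    simpa using this
  exact squeeze_zero_norm' ((eventually_ge_atTop 1).mono hbound) hrhs

lemma eq_zero_of_periodic_of_tendsto {p : ℕ} (hp : 1 ≤ p) (hper : ∀ n, α (n + p) = α n)
    (hlim : Tendsto α atTop (𝓝 0)) (n : ℕ) : α n = 0 := by
  have h1 : ∀ k, α (n + k * p) = α n := by
    intro k
    have := (show Function.Periodic α p from hper).nat_mul k n
    simpa using this
  have h2 : Tendsto (fun k => n + k * p) atTop atTop :=
    tendsto_atTop_mono (fun k => (Nat.le_mul_of_pos_right k hp).trans (Nat.le_add_left _ n)) tendsto_id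
  have h3 := hlim.comp h2
  simp only [Function.comp_def, h1] at h3
  exact tendsto_nhds_unique tendsto_const_nhds h3

lemma IsVerblunsky.mem_support_of_isLimitOfZeros (h : IsVerblunsky μ α) {z₀ : ℂ}
    (hnot : ¬ Tendsto α atTop (𝓝 0)) (hlim : IsLimitOfZeros (phi α) z₀) : z₀ ∈ μ.support := by
  have hz₀ : ¬ ‖z₀‖ < 1 := fun hz => hnot (h.tendsto_zero_of_isLimitOfZeros hz hlim)
  by_contra hsupp
  obtain ⟨U, hU, hμU⟩ := Measure.notMem_support_iff_exists.1 hsupp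
  obtain ⟨ε, hε, hball⟩ := Metric.mem_nhds_iff.1 hU
  have hae : ∀ᵐ z ∂μ, ε ≤ ‖z - z₀‖ := by
    rw [ae_iff]
    refine measure_mono_null (fun z hz => hball ?_) hμU
    simpa [dist_eq_norm] using hz
  obtain ⟨z, hz, hlim⟩ := hlim
  have hnear : ∀ᶠ n in atTop, ‖z n - z₀‖ < ε / 2 := by
    have := Metric.tendsto_nhds.1 hlim (ε / 2) (by positivity)
    simpa [dist_eq_norm] using this
  have hev : ∀ᶠ n in atTop, (ε / 2) ^ 2 ≤ 1 - ‖z n‖ ^ 2 := by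
    filter_upwards [hnear, eventually_ge_atTop 1] with n hn hn1
    refine h.sq_le_one_sub_norm_sq (by positivity) ?_ (hz n hn1)
    filter_upwards [hae] with w hw
    have := norm_sub_le_norm_sub_add_norm_sub w (z n) z₀
    linarith
  -- In the limit `1 - |z₀|² ≥ (ε / 2)²`, although `|z₀| ≥ 1`.
  have hge := ge_of_tendsto ((hlim.norm.pow 2).const_sub 1) hev
  nlinarith [norm_nonneg z₀, sq_pos_of_pos hε]

end Measure

/-! ### Transfer matrices over a period -/

section Transfer

variable {α : ℕ → ℂ}

/-- The matrix that carries `(φₙ, φₙ*)` to `(φₙ₊₁, φₙ₊₁*)` when `αₙ = a`. -/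
noncomputable def szegoMatrix (a : ℂ) : Matrix (Fin 2) (Fin 2) ℂ[X] :=
  C ((rho a : ℂ)⁻¹) • !![X, -C (conj a); -(C a * X), 1]

/-- The matrix that carries `(φₙ, φₙ*)` to `(φₙ₊ₖ, φₙ₊ₖ*)`. -/
noncomputable def transfer (α : ℕ → ℂ) (n : ℕ) : ℕ → Matrix (Fin 2) (Fin 2) ℂ[X]
  | 0 => 1
  | k + 1 => szegoMatrix (α (n + k)) * transfer α n k

lemma transfer_succ_zero (α : ℕ → ℂ) (n k : ℕ) (j : Fin 2) :
    transfer α n (k + 1) 0 j = C ((rho (α (n + k)) : ℂ)⁻¹)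
      * (X * transfer α n k 0 j - C (conj (α (n + k))) * transfer α n k 1 j) := by
  simp [transfer, szegoMatrix, Matrix.mul_apply, Fin.sum_univ_two]
  ring

lemma transfer_succ_one (α : ℕ → ℂ) (n k : ℕ) (j : Fin 2) :
    transfer α n (k + 1) 1 j = C ((rho (α (n + k)) : ℂ)⁻¹)
      * (transfer α n k 1 j - C (α (n + k)) * (X * transfer α n k 0 j)) := by
  simp [transfer, szegoMatrix, Matrix.mul_apply, Fin.sum_univ_two]
  ring

lemma phi_add (α : ℕ → ℂ) (n k : ℕ) :
    phi α (n + k) = transfer α n k 0 0 * phi α n + transfer α n k 0 1 * reversed n (phi α n) ∧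
    reversed (n + k) (phi α (n + k))
      = transfer α n k 1 0 * phi α n + transfer α n k 1 1 * reversed n (phi α n) := by
  induction k with
  | zero => simp [transfer]
  | succ k ih =>
    obtain ⟨h1, h2⟩ := ih
    rw [← add_assoc, reversed_phi_succ, phi, h2, h1]
    simp only [transfer_succ_zero, transfer_succ_one]
    constructor <;> ring

lemma transfer_add_period {p : ℕ} (hper : ∀ n, α (n + p) = α n) (n k : ℕ) :
    transfer α (n + p) k = transfer α n k := by
  induction k with
  | zero => rfl
  | succ k ih => rw [transfer, transfer, ih, add_right_comm, hper]

lemma coeff_zero_transfer_one_one_ne_zero (hα : ∀ n, ‖α n‖ < 1) (n k : ℕ) :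
    (transfer α n k 1 1).coeff 0 ≠ 0 := by
  induction k with
  | zero => simp [transfer]
  | succ k ih =>
    rw [transfer_succ_one]
    simp [ih, ofReal_rho_ne_zero (hα (n + k)), mul_coeff_zero]

/-- If the upper right entry vanishes, comparison of constant terms in the last step of the product
shows that the last coefficient is `0`; then the entry of the shorter product vanishes too. -/
lemma eq_zero_of_transfer_zero_one_eq_zero (hα : ∀ n, ‖α n‖ < 1) (n k : ℕ)
    (h : transfer α n k 0 1 = 0) : ∀ i < k, α (n + i) = 0 := by
  induction k with
  | zero => simp
  | succ k ih =>
    rw [transfer_succ_zero, mul_eq_zero, C_eq_zero] at h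
    have h1 := h.resolve_left (inv_ne_zero (ofReal_rho_ne_zero (hα (n + k))))
    have h2 : α (n + k) = 0 := by
      have h3 := congrArg (fun P : ℂ[X] => P.coeff 0) h1
      simpa [mul_coeff_zero, coeff_zero_transfer_one_one_ne_zero hα n k] using h3
    rw [h2, map_zero, C_0, zero_mul, sub_zero, mul_eq_zero] at h1
    intro i hi
    rcases Nat.lt_succ_iff_lt_or_eq.1 hi with hi | rfl
    · exact ih (h1.resolve_left X_ne_zero) i hi
    · exact h2

lemma transfer_period_zero_one_ne_zero (hα : ∀ n, ‖α n‖ < 1) {p : ℕ} (hp : 1 ≤ p)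
    (hper : ∀ n, α (n + p) = α n) (hne : ∃ n, α n ≠ 0) (n : ℕ) : transfer α n p 0 1 ≠ 0 := by
  intro h
  have h1 := eq_zero_of_transfer_zero_one_eq_zero hα n p h
  obtain ⟨m, hm⟩ := hne
  have hP : Function.Periodic α p := hper
  have hP' : Function.Periodic (fun i => α (n + i)) p := fun i => by
    simp only [← add_assoc, hper]
  apply hm
  have h2 : α (m + n * p) = α m := by simpa using hP.nat_mul n m
  have h3 : n ≤ m + n * p := (Nat.le_mul_of_pos_right n hp).trans (Nat.le_add_left _ m)
  rw [← h2, ← Nat.add_sub_cancel' h3]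
  have h4 := hP'.map_mod_nat (m + n * p - n)
  rw [← h4]
  exact h1 _ (Nat.mod_lt _ hp)

lemma exists_eval_transfer_ne_zero (hα : ∀ n, ‖α n‖ < 1) {p : ℕ} (hp : 1 ≤ p)
    (hper : ∀ n, α (n + p) = α n) (hne : ∃ n, α n ≠ 0) :
    ∃ w : ℂ, ‖w‖ < 1 ∧ ∀ n, (transfer α n p 0 1).eval w ≠ 0 := by
  set Q := ∏ n ∈ Finset.range p, transfer α n p 0 1 with hQ
  have hQ0 : Q ≠ 0 :=
    Finset.prod_ne_zero_iff.2 fun n _ => transfer_period_zero_one_ne_zero hα hp hper hne n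
  have hinf : (Metric.ball (0 : ℂ) 1).Infinite :=
    infinite_of_mem_nhds 0 (Metric.ball_mem_nhds 0 one_pos)
  obtain ⟨w, hw, hwQ⟩ := hinf.exists_notMem_finset Q.roots.toFinset
  have hP : Function.Periodic (fun n => transfer α n p 0 1) p := fun n => by
    simp only [transfer_add_period hper n p]
  refine ⟨w, by simpa using hw, fun n h => hwQ ?_⟩
  have hn : (transfer α (n % p) p 0 1).eval w = 0 := (congrArg (eval w) (hP.map_mod_nat n)).trans h
  rw [Multiset.mem_toFinset, mem_roots hQ0, IsRoot, hQ, eval_prod]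
  exact Finset.prod_eq_zero (Finset.mem_range.2 (Nat.mod_lt n hp)) hn

lemma exists_forall_le_of_periodic {p : ℕ} (hp : 1 ≤ p) {f : ℕ → ℝ} (hf : Function.Periodic f p) :
    ∃ m, ∀ n, f m ≤ f n := by
  obtain ⟨m, -, hm⟩ := Finset.exists_min_image (Finset.range p) f ⟨0, Finset.mem_range.2 hp⟩
  exact ⟨m, fun n => by
    rw [← hf.map_mod_nat n]
    exact hm _ (Finset.mem_range.2 (Nat.mod_lt n hp))⟩

/-- `(φₙ, φₙ*)` and `(φₙ₊ₚ, φₙ₊ₚ*)` solve the same recursion, whose step matrices have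
determinant `z`. -/
lemma wronskian_eq (hα : ∀ n, ‖α n‖ < 1) {p : ℕ} (hper : ∀ n, α (n + p) = α n) (w : ℂ) (n : ℕ) :
    (phi α (n + p)).eval w * (reversed n (phi α n)).eval w
        - (phi α n).eval w * (reversed (n + p) (phi α (n + p))).eval w
      = w ^ n * ((phi α p).eval w - (reversed p (phi α p)).eval w) := by
  induction n with
  | zero => simp [phi, reversed_zero_one]
  | succ n ih =>
    have hr := ofReal_rho_ne_zero (hα n)
    have hr2 : (rho (α n) : ℂ) ^ 2 = 1 - α n * conj (α n) := by
      rw [Complex.mul_conj']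
      exact_mod_cast rho_sq (hα n)
    have a1 := rho_mul_eval_phi_succ hα n w
    have a2 := rho_mul_eval_reversed_phi_succ hα n w
    have b1 := rho_mul_eval_phi_succ hα (n + p) w
    have b2 := rho_mul_eval_reversed_phi_succ hα (n + p) w
    rw [hper] at b1 b2
    rw [add_right_comm, pow_succ', mul_assoc, ← ih]
    apply mul_left_cancel₀ (pow_ne_zero 2 hr)
    generalize (phi α (n + 1)).eval w = u1 at *
    generalize (phi α (n + p + 1)).eval w = u2 at *
    generalize (reversed (n + 1) (phi α (n + 1))).eval w = v1 at *
    generalize (reversed (n + p + 1) (phi α (n + p + 1))).eval w = v2 at *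
    calc (rho (α n) : ℂ) ^ 2 * (u2 * v1 - u1 * v2)
        = (rho (α n) * u2) * (rho (α n) * v1) - (rho (α n) * u1) * (rho (α n) * v2) := by ring
      _ = _ := by
        rw [a1, a2, b1, b2, hr2]
        ring

/-- With `u = φₙ(w)`, `v = φₙ*(w)` and transfer matrix entries `a, b, c, d` the Wronskian is
`b v² + (a - d) u v - c u²`. As it tends to `0` while `|b|` and `|v|` are bounded below, `|u / v|` is
bounded below. -/
lemma exists_lower_bound (hα : ∀ n, ‖α n‖ < 1) {p : ℕ} (hp : 1 ≤ p)
    (hper : ∀ n, α (n + p) = α n) {w : ℂ} (hw : ‖w‖ < 1)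
    (hB : ∀ n, (transfer α n p 0 1).eval w ≠ 0) :
    ∃ c > 0, ∀ᶠ n in atTop,
      c * ‖(reversed n (phi α n)).eval w‖ ≤ ‖(phi α n).eval w‖ := by
  have hT : ∀ n, transfer α (n + p) p = transfer α n p := fun n => transfer_add_period hper n p
  obtain ⟨m, hm⟩ := exists_forall_le_of_periodic hp
    (f := fun n => ‖(transfer α n p 0 1).eval w‖) (fun n => by simp only [hT])
  obtain ⟨m', hm'⟩ := exists_forall_le_of_periodic hp
    (f := fun n => -(‖(transfer α n p 0 0).eval w‖ + ‖(transfer α n p 1 1).eval w‖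
      + ‖(transfer α n p 1 0).eval w‖)) (fun n => by simp only [hT])
  set β := ‖(transfer α m p 0 1).eval w‖ with hβ
  set K := ‖(transfer α m' p 0 0).eval w‖ + ‖(transfer α m' p 1 1).eval w‖
      + ‖(transfer α m' p 1 0).eval w‖ + 1 with hK
  have hβ0 : 0 < β := norm_pos_iff.2 (hB m)
  have hK0 : 0 < K := by positivity
  set W := (phi α p).eval w - (reversed p (phi α p)).eval w with hW
  have hg : 0 < 1 - ‖w‖ ^ 2 := by nlinarith [norm_nonneg w]
  have hsmall : ∀ᶠ n in atTop, ‖w‖ ^ n * ‖W‖ ≤ β / 2 * (1 - ‖w‖ ^ 2) := by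
    have h1 := (tendsto_pow_atTop_nhds_zero_of_lt_one (norm_nonneg w) hw).mul_const ‖W‖
    rw [zero_mul] at h1
    exact h1.eventually_le_const (by positivity)
  refine ⟨β / (2 * K), by positivity, ?_⟩
  filter_upwards [hsmall] with n hn
  obtain ⟨e1, e2⟩ := phi_add α n p
  have e1' := congrArg (eval w) e1
  have e2' := congrArg (eval w) e2
  simp only [eval_add, eval_mul] at e1' e2'
  have hwr := wronskian_eq hα hper w n
  rw [e1', e2', ← hW] at hwr
  have hmn := hm n
  have hmn' := hm' n
  have huv := norm_phi_le_norm_reversed hα n hw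
  have hv0 := norm_pos_iff.2 (reversed_phi_eval_ne_zero hα n hw)
  have hv2 := one_sub_norm_sq_le_norm_sq_reversed hα n hw
  set u := (phi α n).eval w
  set v := (reversed n (phi α n)).eval w
  generalize (transfer α n p 0 0).eval w = a at *
  generalize (transfer α n p 0 1).eval w = b at *
  generalize (transfer α n p 1 0).eval w = c at *
  generalize (transfer α n p 1 1).eval w = d at *
  have hb : b * v ^ 2 = w ^ n * W - (a - d) * u * v + c * u * u := by
    rw [← hwr]; ring
  have hb2 : ‖b‖ * ‖v‖ ^ 2 ≤ ‖w‖ ^ n * ‖W‖ + (‖a‖ + ‖d‖) * ‖u‖ * ‖v‖ + ‖c‖ * ‖u‖ * ‖v‖ := by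
    calc ‖b‖ * ‖v‖ ^ 2 = ‖w ^ n * W - (a - d) * u * v + c * u * u‖ := by
          rw [← hb, norm_mul, norm_pow]
      _ ≤ ‖w ^ n * W‖ + ‖(a - d) * u * v‖ + ‖c * u * u‖ :=
          (norm_add_le _ _).trans (by gcongr; exact norm_sub_le _ _)
      _ ≤ _ := by
          simp only [norm_mul, norm_pow]
          gcongr
          exact norm_sub_le _ _
  have hb3 : β * ‖v‖ ^ 2 ≤ β / 2 * ‖v‖ ^ 2 + K * ‖u‖ * ‖v‖ := by
    have i1 : β * ‖v‖ ^ 2 ≤ ‖b‖ * ‖v‖ ^ 2 := by gcongr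
    have i2 : (‖a‖ + ‖d‖ + ‖c‖) * (‖u‖ * ‖v‖) ≤ K * (‖u‖ * ‖v‖) := by
      gcongr
      linarith
    have i3 : β / 2 * (1 - ‖w‖ ^ 2) ≤ β / 2 * ‖v‖ ^ 2 := by gcongr
    linarith
  rw [div_mul_eq_mul_div, div_le_iff₀ (by positivity)]
  refine le_of_mul_le_mul_right ?_ hv0
  linarith

end Transfer

/-! ### Zeros near points of the support -/

section Zeros

variable {μ : Measure ℂ} {α : ℕ → ℂ}

/-- If `φₙ/φₙ*` stays away from `0` at a point of the disk then the zeros of `φₙ` satisfy the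
Blaschke condition uniformly in `n`. -/
lemma IsVerblunsky.exists_sum_roots_le (h : IsVerblunsky μ α) {w : ℂ} (hw : ‖w‖ < 1) {c : ℝ}
    (hc : 0 < c) : ∃ M : ℝ, ∀ n, c * ‖(reversed n (phi α n)).eval w‖ ≤ ‖(phi α n).eval w‖ →
      ((phi α n).roots.map fun a => 1 - ‖a‖ ^ 2).sum ≤ M := by
  have hg : 0 < 1 - ‖w‖ ^ 2 := by nlinarith [norm_nonneg w]
  refine ⟨4 / (1 - ‖w‖ ^ 2) * -Real.log (c ^ 2), fun n hn => ?_⟩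
  have hroots := h.norm_lt_one_of_mem_roots n
  have hv0 := norm_pos_iff.2 (reversed_phi_eval_ne_zero h.norm_lt_one n hw)
  have h1 := norm_phi_sq_eq h.norm_lt_one n hroots hw.le
  set s := (phi α n).roots
  have h2 : c ^ 2 ≤ (s.map (blaschkeSq w)).prod := by
    refine le_of_mul_le_mul_right ?_ (pow_pos hv0 2)
    rw [← h1, ← mul_pow]
    gcongr
  have h3 := h2.trans (prod_le_exp_neg_sum fun a _ => blaschkeSq_nonneg w a)
  have h4 := (Real.log_le_iff_le_exp (by positivity)).2 h3
  have h5 : (s.map fun a => (1 - ‖w‖ ^ 2) / 4 * (1 - ‖a‖ ^ 2)).sum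
      ≤ (s.map fun a => 1 - blaschkeSq w a).sum := by
    refine Multiset.sum_map_le_sum_map _ _ fun a ha => ?_
    have ha1 := hroots a ha
    have hn0 := norm_pos_iff.2 (one_sub_conj_mul_ne_zero ha1 hw.le)
    have hn2 : ‖1 - conj a * w‖ ≤ 2 := by
      have := norm_sub_le 1 (conj a * w)
      rw [norm_one, norm_mul, RCLike.norm_conj] at this
      nlinarith [norm_nonneg a, norm_nonneg w]
    have ha2 : 0 ≤ 1 - ‖a‖ ^ 2 := by nlinarith [norm_nonneg a]
    rw [one_sub_blaschkeSq ha1 hw.le, div_mul_eq_mul_div]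
    have hn4 : ‖1 - conj a * w‖ ^ 2 ≤ 4 := by nlinarith
    gcongr
  rw [Multiset.sum_map_mul_left] at h5
  rw [div_mul_eq_mul_div, le_div_iff₀ hg]
  linarith

/-- On the unit circle the Christoffel–Darboux sum divided by `|φₙ|²` is the sum over the zeros `a`
of `φₙ` of the Poisson kernels `(1 - |a|²) / |ζ - a|²`; the inequality needed here is obtained by
letting `z → ζ` radially. -/
lemma IsVerblunsky.sum_norm_sq_phi_le (h : IsVerblunsky μ α) (n : ℕ) {ζ : ℂ} (hζ : ‖ζ‖ = 1)
    {δ : ℝ} (hδ : 0 < δ) (hdist : ∀ a ∈ (phi α n).roots, δ ≤ ‖ζ - a‖) :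
    ∑ k ∈ Finset.range n, ‖(phi α k).eval ζ‖ ^ 2
      ≤ ((phi α n).roots.map fun a => 1 - ‖a‖ ^ 2).sum / δ ^ 2 * ‖(phi α n).eval ζ‖ ^ 2 := by
  have hroots := h.norm_lt_one_of_mem_roots n
  set s := (phi α n).roots with hs
  set S := (s.map fun a => 1 - ‖a‖ ^ 2).sum with hS
  have hrad : ∀ r : ℝ, 0 < r → r < 1 → 1 - δ < r →
      ∑ k ∈ Finset.range n, ‖(phi α k).eval (r * ζ)‖ ^ 2
        ≤ S / (δ - (1 - r)) ^ 2 * ‖(reversed n (phi α n)).eval (r * ζ)‖ ^ 2 := by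
    intro r hr0 hr1 hrδ
    have hz : ‖(r : ℂ) * ζ‖ = r := by simp [hζ, abs_of_pos hr0]
    have hz1 : ‖(r : ℂ) * ζ‖ < 1 := by rwa [hz]
    set z := (r : ℂ) * ζ with hzdef
    have hg : 0 < 1 - ‖z‖ ^ 2 := by nlinarith [norm_nonneg z]
    have hcd := norm_sq_reversed_phi_sub h.norm_lt_one n z
    rw [norm_phi_sq_eq h.norm_lt_one n hroots hz1.le] at hcd
    obtain ⟨h1, -, -⟩ := one_sub_sum_le_prod (s := s) (x := blaschkeSq z)
      (fun a _ => blaschkeSq_nonneg z a) (fun a ha => blaschkeSq_le_one (hroots a ha) hz1.le)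
    have h2 : (s.map fun a => 1 - blaschkeSq z a).sum
        ≤ (s.map fun a => (1 - ‖z‖ ^ 2) / (δ - (1 - r)) ^ 2 * (1 - ‖a‖ ^ 2)).sum := by
      refine Multiset.sum_map_le_sum_map _ _ fun a ha => ?_
      have ha1 := hroots a ha
      have ha2 : 0 ≤ 1 - ‖a‖ ^ 2 := by nlinarith [norm_nonneg a]
      -- On the circle `|1 - conj a * ζ| = |ζ - a|`; moving from `ζ` to `z = r ζ` costs `1 - r`.
      have hcirc : ‖1 - conj a * ζ‖ = ‖ζ - a‖ := by
        have := norm_one_sub_conj_mul_sq_sub a ζ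
        rw [hζ] at this
        exact (sq_eq_sq₀ (norm_nonneg _) (norm_nonneg _)).1 (by linarith)
      have hlow : δ - (1 - r) ≤ ‖1 - conj a * z‖ := by
        have e : conj a * z - conj a * ζ = conj a * (((r - 1 : ℝ) : ℂ) * ζ) := by
          rw [hzdef]; push_cast; ring
        have h3 : ‖conj a * z - conj a * ζ‖ ≤ 1 - r := by
          rw [e, norm_mul, norm_mul, RCLike.norm_conj, Complex.norm_real, hζ, mul_one,
            Real.norm_eq_abs, abs_of_neg (by linarith)]
          nlinarith [norm_nonneg a]
        have h4 := norm_sub_le_norm_sub_add_norm_sub (1 : ℂ) (conj a * z) (conj a * ζ)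
        have h5 := hdist a ha
        rw [hcirc] at h4
        linarith
      have hpos : 0 < δ - (1 - r) := by linarith
      rw [one_sub_blaschkeSq ha1 hz1.le, div_mul_eq_mul_div]
      gcongr
    rw [Multiset.sum_map_mul_left] at h2
    refine le_of_mul_le_mul_left ?_ hg
    rw [← hcd]
    calc _ = (1 - (s.map (blaschkeSq z)).prod) * ‖(reversed n (phi α n)).eval z‖ ^ 2 := by ring
      _ ≤ ((1 - ‖z‖ ^ 2) / (δ - (1 - r)) ^ 2 * S) * ‖(reversed n (phi α n)).eval z‖ ^ 2 := by
        gcongr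
        linarith
      _ = _ := by ring
  have hL : Tendsto (fun r : ℝ => ∑ k ∈ Finset.range n, ‖(phi α k).eval (r * ζ)‖ ^ 2) (𝓝[<] 1)
      (𝓝 (∑ k ∈ Finset.range n, ‖(phi α k).eval ζ‖ ^ 2)) := by
    have hcont : Continuous fun r : ℝ => ∑ k ∈ Finset.range n, ‖(phi α k).eval (r * ζ)‖ ^ 2 := by
      fun_prop
    simpa using (hcont.tendsto 1).mono_left nhdsWithin_le_nhds
  have hR : Tendsto (fun r : ℝ => S / (δ - (1 - r)) ^ 2
      * ‖(reversed n (phi α n)).eval (r * ζ)‖ ^ 2) (𝓝[<] 1)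
      (𝓝 (S / δ ^ 2 * ‖(phi α n).eval ζ‖ ^ 2)) := by
    have hcont : ContinuousAt (fun r : ℝ => S / (δ - (1 - r)) ^ 2
        * ‖(reversed n (phi α n)).eval (r * ζ)‖ ^ 2) 1 := by
      refine ContinuousAt.mul (ContinuousAt.div ?_ ?_ ?_) ?_
      · fun_prop
      · fun_prop
      · simpa using hδ.ne'
      · exact Continuous.continuousAt (by fun_prop)
    have := hcont.tendsto.mono_left (nhdsWithin_le_nhds (s := Set.Iio 1))
    simpa [norm_reversed_phi_of_norm_eq_one α n hζ] using this
  refine le_of_tendsto_of_tendsto hL hR ?_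
  have hlt : max 0 (1 - δ) < (1 : ℝ) := max_lt one_pos (by linarith)
  filter_upwards [Ioo_mem_nhdsLT hlt] with r hr
  exact hrad r ((le_max_left _ _).trans_lt hr.1) hr.2 ((le_max_right _ _).trans_lt hr.1)

/-- Otherwise `∑_{k < n} |φₖ|²` is, for infinitely many `n`, at most a constant times `|φₙ|²` on an
arc of positive measure. -/
lemma IsVerblunsky.eventually_exists_root (h : IsVerblunsky μ α) {z₀ : ℂ} (hz₀ : z₀ ∈ μ.support)
    {M : ℝ} (hM : ∀ᶠ n in atTop, ((phi α n).roots.map fun a => 1 - ‖a‖ ^ 2).sum ≤ M)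
    {ε : ℝ} (hε : 0 < ε) : ∀ᶠ n in atTop, ∃ a, (phi α n).eval a = 0 ∧ dist a z₀ < ε := by
  by_contra hcon
  have hfreq : ∃ᶠ n in atTop, (∀ a ∈ (phi α n).roots, ε ≤ ‖a - z₀‖) ∧
      ((phi α n).roots.map fun a => 1 - ‖a‖ ^ 2).sum ≤ M := by
    refine ((not_eventually.1 hcon).mono fun n hn a ha => ?_).and_eventually hM
    by_contra! hlt
    exact hn ⟨a, isRoot_of_mem_roots ha, by rwa [dist_eq_norm]⟩
  set s := Metric.ball z₀ (ε / 2) with hs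
  set C₁ := M / (ε / 2) ^ 2 with hC₁
  have hbound : ∃ᶠ n in atTop, ∀ ζ ∈ s, ‖ζ‖ = 1 →
      ∑ k ∈ Finset.range n, ‖(phi α k).eval ζ‖ ^ 2 ≤ C₁ * ‖(phi α n).eval ζ‖ ^ 2 := by
    refine hfreq.mono fun n hn ζ hζs hζ => ?_
    refine (h.sum_norm_sq_phi_le n hζ (half_pos hε) fun a ha => ?_).trans ?_
    · have h1 := hn.1 a ha
      have h2 := norm_sub_le_norm_sub_add_norm_sub a ζ z₀
      rw [hs, Metric.mem_ball, dist_eq_norm] at hζs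
      rw [norm_sub_rev]
      linarith
    · rw [hC₁]
      gcongr
      exact hn.2
  -- Integrating, `∑ₖ ∫ |φₖ|²` over the ball is finite, so `φₖ → 0` almost everywhere there.
  have hnn : ∀ k, Measurable fun ζ : ℂ => ENNReal.ofReal (‖(phi α k).eval ζ‖ ^ 2) := fun k => by
    fun_prop
  have hlint : ∀ k, ∫⁻ ζ in s, ENNReal.ofReal (‖(phi α k).eval ζ‖ ^ 2) ∂μ ≤ 1 := fun k => by
    refine (setLIntegral_le_lintegral _ _).trans ?_
    rw [← ofReal_integral_eq_lintegral_ofReal (h.integrable (by fun_prop))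
      (ae_of_all _ fun ζ => by positivity), h.integral_norm_sq_phi, ENNReal.ofReal_one]
  have hpartial : ∀ N, ∑ k ∈ Finset.range N,
      ∫⁻ ζ in s, ENNReal.ofReal (‖(phi α k).eval ζ‖ ^ 2) ∂μ ≤ ENNReal.ofReal C₁ := by
    intro N
    obtain ⟨n, hn, hNn⟩ := (hbound.and_eventually (eventually_ge_atTop N)).exists
    calc _ ≤ ∑ k ∈ Finset.range n, ∫⁻ ζ in s, ENNReal.ofReal (‖(phi α k).eval ζ‖ ^ 2) ∂μ :=
          Finset.sum_le_sum_of_subset (Finset.range_mono hNn)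
      _ = ∫⁻ ζ in s, ∑ k ∈ Finset.range n, ENNReal.ofReal (‖(phi α k).eval ζ‖ ^ 2) ∂μ :=
          (lintegral_finsetSum _ fun k _ => hnn k).symm
      _ ≤ ∫⁻ ζ in s, ENNReal.ofReal C₁ * ENNReal.ofReal (‖(phi α n).eval ζ‖ ^ 2) ∂μ := by
          refine lintegral_mono_ae ?_
          filter_upwards [ae_restrict_mem measurableSet_ball,
            ae_restrict_of_ae h.ae_norm_eq_one] with ζ hζs hζ
          rw [← ENNReal.ofReal_sum_of_nonneg fun k _ => by positivity,
            ← ENNReal.ofReal_mul' (by positivity)]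
          exact ENNReal.ofReal_le_ofReal (hn ζ hζs hζ)
      _ = ENNReal.ofReal C₁ * ∫⁻ ζ in s, ENNReal.ofReal (‖(phi α n).eval ζ‖ ^ 2) ∂μ :=
          lintegral_const_mul _ (hnn n)
      _ ≤ ENNReal.ofReal C₁ * 1 := by gcongr; exact hlint n
      _ = _ := mul_one _
  have htsum : ∫⁻ ζ in s, ∑' k, ENNReal.ofReal (‖(phi α k).eval ζ‖ ^ 2) ∂μ ≠ ⊤ := by
    rw [lintegral_tsum fun k => (hnn k).aemeasurable]
    refine ne_top_of_le_ne_top ENNReal.ofReal_ne_top (b := ENNReal.ofReal C₁) ?_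
    rw [ENNReal.tsum_eq_iSup_nat]
    exact iSup_le hpartial
  have hae : ∀ᵐ ζ ∂μ.restrict s, ∑' k, ENNReal.ofReal (‖(phi α k).eval ζ‖ ^ 2) < ⊤ :=
    ae_lt_top (Measurable.tsum hnn) htsum
  have hμs : 0 < μ s :=
    (Measure.mem_support_iff_forall z₀).1 hz₀ s (Metric.ball_mem_nhds z₀ (half_pos hε))
  have : NeBot (ae (μ.restrict s)) := ae_neBot.2 (by
    rw [Ne, Measure.restrict_eq_zero]; exact hμs.ne')
  obtain ⟨ζ, hsum, hζs, hζ⟩ := (hae.and ((ae_restrict_mem measurableSet_ball).and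
    (ae_restrict_of_ae h.ae_norm_eq_one))).exists
  have hzero : Tendsto (fun k => C₁ * ‖(phi α k).eval ζ‖ ^ 2) atTop (𝓝 0) := by
    have h1 := ENNReal.tendsto_atTop_zero_of_tsum_ne_top hsum.ne
    have h2 := (ENNReal.tendsto_toReal ENNReal.zero_ne_top).comp h1
    have h3 : Tendsto (fun k => ‖(phi α k).eval ζ‖ ^ 2) atTop (𝓝 0) := by
      refine h2.congr fun k => ?_
      simp
    simpa using h3.const_mul C₁
  obtain ⟨n, hn, hlt, hn1⟩ := (hbound.and_eventually
    ((hzero.eventually_lt_const one_pos).and (eventually_ge_atTop 1))).exists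
  have := hn ζ hζs hζ
  have := one_le_sum_norm_sq_phi α hn1 ζ
  linarith

lemma isLimitOfZeros_of_eventually {P : ℕ → ℂ[X]} {z₀ : ℂ} (hP0 : ∀ n, P n ≠ 0)
    (hroot : ∀ n, 1 ≤ n → ∃ a, (P n).eval a = 0)
    (hev : ∀ ε > 0, ∀ᶠ n in atTop, ∃ a, (P n).eval a = 0 ∧ dist a z₀ < ε) :
    IsLimitOfZeros P z₀ := by
  -- Choose a zero of `P n` closest to `z₀`.
  have hmin : ∀ n, 1 ≤ n → ∃ a, (P n).eval a = 0 ∧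
      ∀ b, (P n).eval b = 0 → dist a z₀ ≤ dist b z₀ := by
    intro n hn
    have hmem : ∀ b, b ∈ (P n).roots.toFinset ↔ (P n).eval b = 0 := fun b => by
      rw [Multiset.mem_toFinset, mem_roots (hP0 n), IsRoot]
    obtain ⟨a₀, ha₀⟩ := hroot n hn
    obtain ⟨a, ha, hle⟩ := Finset.exists_min_image (P n).roots.toFinset (fun b => dist b z₀)
      ⟨a₀, (hmem a₀).2 ha₀⟩
    exact ⟨a, (hmem a).1 ha, fun b hb => hle b ((hmem b).2 hb)⟩
  choose! z hz hle using hmin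
  refine ⟨z, hz, Metric.tendsto_nhds.2 fun ε hε => ?_⟩
  filter_upwards [hev ε hε, eventually_ge_atTop 1] with n hn hn1
  obtain ⟨a, ha, hlt⟩ := hn
  exact (hle n hn1 a ha).trans_lt hlt

end Zeros

end OPUC

theorem theorem3p3 (μ : Measure ℂ) (α : ℕ → ℂ) (hα : OPUC.IsVerblunsky μ α)
    (p : ℕ) (hp : 1 ≤ p) (hper : ∀ n, α (n + p) = α n) (hne : ∃ n, α n ≠ 0) (z₀ : ℂ) :
    OPUC.IsLimitOfZeros (OPUC.phi α) z₀ ↔ z₀ ∈ μ.support := by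
  constructor
  · refine hα.mem_support_of_isLimitOfZeros fun hlim => ?_
    obtain ⟨n, hn⟩ := hne
    exact hn (OPUC.eq_zero_of_periodic_of_tendsto hp hper hlim n)
  · intro hz₀
    have hα1 := hα.norm_lt_one
    obtain ⟨w, hw, hB⟩ := OPUC.exists_eval_transfer_ne_zero hα1 hp hper hne
    obtain ⟨c, hc, hlow⟩ := OPUC.exists_lower_bound hα1 hp hper hw hB
    obtain ⟨M, hM⟩ := hα.exists_sum_roots_le hw hc
    refine OPUC.isLimitOfZeros_of_eventually (OPUC.phi_ne_zero hα1) (fun n hn => ?_)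
      fun ε hε => hα.eventually_exists_root hz₀ (hlow.mono hM) hε
    refine Complex.exists_root (natDegree_pos_iff_degree_pos.1 ?_)
    rw [OPUC.natDegree_phi hα1]
    exact hn
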